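/- Notation. $\mathbb D$ is the open unit disc in $\mathbb C$. For a metric space $E$, $X(E)$ is the set of continuous curves $\gamma:[0,1]\to E$ modulo reparametrization, with the metric $d(\gamma,\tilde\gamma)=\inf_\psi\sup_{t\in[0,1]}d_E(\gamma(t),\tilde\gamma(\psi(t)))$, where $\psi$ runs over the increasing bijections of $[0,1]$ and curves at distance $0$ are identified; it carries its Borel $\sigma$-algebra. A continuous map $F:E\to E'$ acts on curves by $\gamma\mapsto F\circ\gamma$, and hence from $X(E)$ to $X(E')$. The space $X(\overline{\mathbb D})$ is identified with the set of those elements of $X(\mathbb C)$ that stay in $\overline{\mathbb D}$. Let $\Lambda$ and $\Lambda_n$ ($n\in\mathbb N$) be bounded simply connected domains in $\mathbb C$ such that: (a) $\Lambda_n\to\Lambda$ in the Carathéodory sense: every $z\in\Lambda$ has a neighbourhood contained in $\Lambda_n$ for all large $n$, and for every $p\in\partial\Lambda$ there are $p_n\in\partial\Lambda_n$ with $p_n\to p$; (b) the complements $\mathbb C\setminus\Lambda_n$ are uniformly locally connected: for every $\varepsilon>0$ there is $\delta>0$, independent of $n$, such that for every $n$ any two points $a,b\in\mathbb C\setminus\Lambda_n$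 with $|a-b|<\delta$ lie in a compact connected set $B\subset\mathbb C\setminus\Lambda_n$ of diameter less than $\varepsilon$. Let $\phi_n:\Lambda_n\to\mathbb D$ and $\phi:\Lambda\to\mathbb D$ be conformal maps (holomorphic bijections) such that $\phi_n^{-1}\to\phi^{-1}$ uniformly on compact subsets of $\mathbb D$. Let $\gamma_{\mathbb D}^{(n)}$ and $\gamma_{\mathbb D}$ be random variables with values in $X(\overline{\mathbb D})$, possibly defined on different probability spaces, such that $\gamma_{\mathbb D}^{(n)}\to\gamma_{\mathbb D}$ weakly in $X(\overline{\mathbb D})$. Then each $\phi_n^{-1}$, and also $\phi^{-1}$, has a unique continuous extension to $\overline{\mathbb D}$ (denoted by the same symbol); the images $\gamma^{(n)}=\phi_n^{-1}(\gamma_{\mathbb D}^{(n)})$ and $\gamma=\phi^{-1}(\gamma_{\mathbb D})$ under these extensions are measurable random variables with values in $X(\mathbb C)$; and $\gamma^{(n)}\to\gamma$ weakly in $X(\mathbb C)$ as $n\to\infty$. -/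

import Mathlib

open Set Filter Topology Metric MeasureTheory

/-! ### Plane domains, kernel convergence, local connectedness -/

/-- Bounded simply connected domains of the complex plane. (`IsSimplyConnected` includes that the
set is nonempty and path connected.) -/
structure IsBoundedSimplyConnectedDomain (U : Set ℂ) : Prop where
  isOpen : IsOpen U
  isSimplyConnected : IsSimplyConnected U
  isBounded : Bornology.IsBounded U

/-- Convergence of the domains `Λ n` to `L` in the Carathéodory sense (kernel convergence with
respect to any base point of `L`): every point of `L` has a neighbourhood that is contained in
`Λ n` for all large `n`, and every boundary point of `L` is a limit of boundary points
of `Λ n`. By the first condition, every point of `L` lies in `Λ n` for all large `n`. -/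
structure CaratheodoryConvergence (Λ : ℕ → Set ℂ) (L : Set ℂ) : Prop where
  eventually_nhds_subset : ∀ z ∈ L, ∃ V ∈ 𝓝 z, ∀ᶠ n in atTop, V ⊆ Λ n
  frontier_approx : ∀ p ∈ frontier L, ∃ q : ℕ → ℂ,
    (∀ n, q n ∈ frontier (Λ n)) ∧ Tendsto q atTop (𝓝 p)

/-- Uniform local connectedness of a sequence of closed plane sets: for every `ε > 0` there is
`δ > 0`, independent of `n`, such that any two points of `A n` at distance less than `δ` lie in a
continuum `B ⊆ A n` of diameter less than `ε`. -/
def UniformlyLocallyConnected (A : ℕ → Set ℂ) : Prop :=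
  (∀ n, IsClosed (A n)) ∧
  ∀ ε > (0 : ℝ), ∃ δ > (0 : ℝ), ∀ n, ∀ a ∈ A n, ∀ b ∈ A n, dist a b < δ →
    ∃ B : Set ℂ, IsCompact B ∧ IsConnected B ∧ a ∈ B ∧ b ∈ B ∧ B ⊆ A n ∧ diam B < ε

/-- `φ` is a conformal map (holomorphic bijection) of `U` onto the open unit disc. The inverse
conformal map is then `φ.symm`, on the open unit disc. -/
structure IsConformalOntoDisc (φ : OpenPartialHomeomorph ℂ ℂ) (U : Set ℂ) : Prop where
  source_eq : φ.source = U
  target_eq : φ.target = ball 0 1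
  differentiableOn : DifferentiableOn ℂ φ U

/-- The closed unit disc. -/
abbrev ClosedDisc : Type := closedBall (0 : ℂ) 1

/-- `F` is a continuous extension to the closed unit disc of the restriction of `f` to the open
unit disc. -/
def IsExtensionToClosedDisc (f : ℂ → ℂ) (F : C(ClosedDisc, ℂ)) : Prop :=
  ∀ z : ClosedDisc, (z : ℂ) ∈ ball (0 : ℂ) 1 → F z = f z

/-! ### Curves modulo reparametrization -/

/-- Parametrized curves in `E`: continuous maps `[0,1] → E`. -/
def ParamCurve (E : Type*) [TopologicalSpace E] : Type _ := C(unitInterval, E)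

namespace ParamCurve

variable {E F : Type*} [MetricSpace E] [MetricSpace F]

/-- The curve `γ ∘ ψ`, for an increasing bijection `ψ` of `[0,1]`. -/
def reparam (γ : ParamCurve E) (ψ : unitInterval ≃o unitInterval) : ParamCurve E :=
  ContinuousMap.comp γ (ContinuousMap.mk ψ ψ.continuous)

/-- `inf_ψ sup_t |γ t - η (ψ t)|`, over the increasing bijections `ψ` of `[0,1]`. -/
noncomputable def reparamDist (γ η : ParamCurve E) : ℝ :=
  ⨅ ψ : unitInterval ≃o unitInterval, ⨆ t : unitInterval, dist (γ.toFun t) (η.toFun (ψ t))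

/-- The uniform distance of two parametrized curves. -/
noncomputable def supDist (γ η : ParamCurve E) : ℝ := dist (α := C(unitInterval, E)) γ η

theorem supDist_eq (γ η : ParamCurve E) :
    supDist γ η = ⨆ t : unitInterval, dist (γ.toFun t) (η.toFun t) :=
  ContinuousMap.dist_eq_iSup (α := unitInterval) (β := E)

theorem supDist_nonneg (γ η : ParamCurve E) : 0 ≤ supDist γ η :=
  dist_nonneg (α := C(unitInterval, E))

theorem reparamDist_eq (γ η : ParamCurve E) :
    reparamDist γ η = ⨅ ψ : unitInterval ≃o unitInterval, supDist γ (η.reparam ψ) := by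
  simp only [supDist_eq]
  rfl

theorem reparamDist_le (γ η : ParamCurve E) (ψ : unitInterval ≃o unitInterval) :
    reparamDist γ η ≤ supDist γ (η.reparam ψ) := by
  rw [reparamDist_eq]
  exact ciInf_le ⟨0, by rintro _ ⟨ψ, rfl⟩; exact supDist_nonneg _ _⟩ ψ

theorem exists_supDist_lt {γ η : ParamCurve E} {r : ℝ} (h : reparamDist γ η < r) :
    ∃ ψ, supDist γ (η.reparam ψ) < r := by
  rw [reparamDist_eq] at h
  exact exists_lt_of_ciInf_lt h

theorem reparamDist_nonneg (γ η : ParamCurve E) : 0 ≤ reparamDist γ η := by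
  rw [reparamDist_eq]
  exact le_ciInf fun ψ => supDist_nonneg _ _

theorem supDist_reparam (γ η : ParamCurve E) (ψ : unitInterval ≃o unitInterval) :
    supDist (γ.reparam ψ) (η.reparam ψ) = supDist γ η := by
  rw [supDist_eq, supDist_eq]
  exact ψ.toEquiv.iSup_congr fun t => rfl

theorem reparam_symm_reparam (γ : ParamCurve E) (ψ : unitInterval ≃o unitInterval) :
    (γ.reparam ψ).reparam ψ.symm = γ :=
  ContinuousMap.ext fun t => congrArg γ.toFun (ψ.apply_symm_apply t)

theorem reparamDist_self (γ : ParamCurve E) : reparamDist γ γ = 0 := by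
  refine le_antisymm ((reparamDist_le γ γ (OrderIso.refl _)).trans ?_) (reparamDist_nonneg _ _)
  exact (dist_self (α := C(unitInterval, E)) γ).le

theorem reparamDist_comm_le (γ η : ParamCurve E) : reparamDist γ η ≤ reparamDist η γ := by
  conv_rhs => rw [reparamDist_eq]
  refine le_ciInf fun ψ => (reparamDist_le γ η ψ.symm).trans ?_
  rw [← supDist_reparam γ (η.reparam ψ.symm) ψ]
  have := reparam_symm_reparam η ψ.symm
  rw [OrderIso.symm_symm] at this
  rw [this]
  exact (dist_comm (α := C(unitInterval, E)) _ _).le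

theorem reparamDist_triangle (γ η ζ : ParamCurve E) :
    reparamDist γ ζ ≤ reparamDist γ η + reparamDist η ζ := by
  refine le_of_forall_pos_lt_add fun ε hε => ?_
  obtain ⟨ψ, hψ⟩ := exists_supDist_lt (lt_add_of_pos_right (reparamDist γ η) (half_pos hε))
  obtain ⟨χ, hχ⟩ := exists_supDist_lt (lt_add_of_pos_right (reparamDist η ζ) (half_pos hε))
  have h1 : reparamDist γ ζ ≤ supDist γ ((ζ.reparam χ).reparam ψ) :=
    reparamDist_le γ ζ (ψ.trans χ)
  have h2 : supDist γ ((ζ.reparam χ).reparam ψ)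
      ≤ supDist γ (η.reparam ψ) + supDist (η.reparam ψ) ((ζ.reparam χ).reparam ψ) :=
    dist_triangle (α := C(unitInterval, E)) _ _ _
  rw [supDist_reparam] at h2
  linarith

noncomputable instance : PseudoMetricSpace (ParamCurve E) where
  dist := reparamDist
  dist_self := reparamDist_self
  dist_comm γ η := le_antisymm (reparamDist_comm_le γ η) (reparamDist_comm_le η γ)
  dist_triangle := reparamDist_triangle

/-- The image curve `f ∘ γ`. -/
def image (f : C(E, F)) (γ : ParamCurve E) : ParamCurve F := ContinuousMap.comp f γ

theorem continuous_image (f : C(E, F)) : Continuous (image f) := by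
  rw [Metric.continuous_iff]
  intro γ ε hε
  obtain ⟨δ, hδ, h⟩ := Metric.continuous_iff.1
    (ContinuousMap.continuous_postcomp (X := unitInterval) f) γ ε hε
  refine ⟨δ, hδ, fun η hη => ?_⟩
  rw [dist_comm] at hη ⊢
  obtain ⟨ψ, hψ⟩ := exists_supDist_lt hη
  refine (reparamDist_le _ _ ψ).trans_lt ?_
  have h3 := h (η.reparam ψ) ((dist_comm (α := C(unitInterval, E)) _ _).trans_lt hψ)
  exact (dist_comm (α := C(unitInterval, F)) _ _).trans_lt h3

end ParamCurve

/-- The space `X(E)` of curves in `E` modulo reparametrization: parametrized curves, where `γ` and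
`η` are identified if `inf_ψ sup_t |γ t - η (ψ t)| = 0`, with that infimum as the metric. -/
def CurveSpace (E : Type*) [MetricSpace E] : Type _ := SeparationQuotient (ParamCurve E)

namespace CurveSpace

variable {E F : Type*} [MetricSpace E] [MetricSpace F]

noncomputable instance : MetricSpace (CurveSpace E) :=
  inferInstanceAs (MetricSpace (SeparationQuotient (ParamCurve E)))

noncomputable instance : MeasurableSpace (CurveSpace E) := borel _

instance : BorelSpace (CurveSpace E) := ⟨rfl⟩

/-- The class of a parametrized curve. -/
noncomputable def mk (γ : ParamCurve E) : CurveSpace E := SeparationQuotient.mk γ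

theorem dist_mk (γ η : ParamCurve E) : dist (mk γ) (mk η) =
    ⨅ ψ : unitInterval ≃o unitInterval, ⨆ t : unitInterval, dist (γ.toFun t) (η.toFun (ψ t)) :=
  rfl

theorem mk_eq_mk_iff (γ η : ParamCurve E) : mk γ = mk η ↔
    ⨅ ψ : unitInterval ≃o unitInterval, ⨆ t : unitInterval,
      dist (γ.toFun t) (η.toFun (ψ t)) = 0 := by
  rw [← dist_mk, dist_eq_zero]

/-- The image of a curve modulo reparametrization under a continuous map: the class of `f ∘ γ`. -/
noncomputable def image (f : C(E, F)) : CurveSpace E → CurveSpace F :=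
  SeparationQuotient.lift (fun γ => mk (ParamCurve.image f γ)) fun _ _ h =>
    SeparationQuotient.mk_eq_mk.2 (h.map (ParamCurve.continuous_image f))

theorem image_mk (f : C(E, F)) (γ : ParamCurve E) :
    image f (mk γ) = mk (ParamCurve.image f γ) := rfl

/-- The space of curves in a subset `S`, modulo reparametrization, is isometrically the subspace of
the curves in `E` that stay in `S`. -/
theorem isometry_image_val (S : Set E) :
    Isometry (image (ContinuousMap.mk (Subtype.val : S → E) continuous_subtype_val)) := by
  refine Isometry.of_dist_eq fun x y => ?_
  obtain ⟨γ, rfl⟩ := SeparationQuotient.surjective_mk x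
  obtain ⟨η, rfl⟩ := SeparationQuotient.surjective_mk y
  rfl

end CurveSpace

/-! The extensions of `φₙ⁻¹` converge to that of `φ⁻¹` uniformly on the closed disc. Composition
with a map moves every curve class by at most the sup distance of the maps, so weak convergence
follows by testing against bounded Lipschitz functions (`tendstoInDistribution_of_uniform`).

Uniform convergence follows from convergence on compact sets and equicontinuity at the unit circle
(`tendsto_extensions`). For equicontinuity, the length-area method (`exists_short_arc`) gives,
around each boundary point, a circular arc with short image; its radius is bounded below in terms of
the area of the domain. The closed image `Q` of the arc has both ends off the domain, and local
connectedness joins them by a small continuum `B` in the complement. Then `B ∪ Q` lies in a small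
disc that misses the image of `0`, so it must trap the image of the region cut off by the arc
(`subset_ball_of_crosscut`).

The estimate needs an area bound and an inner radius, both uniform in `n`. The radius comes from
kernel convergence and `φₙ⁻¹(0) → φ⁻¹(0)`; the area bound from
`CaratheodoryConvergence.eventually_subset_ball`, since uniform boundedness is not assumed.

All plane topology is done with continuous logarithms: a point of a bounded set is separated from
infinity by the frontier because `z - p` has no continuous logarithm there. -/

open scoped ENNReal

/-! ### Continuous logarithms and separation in the plane -/

/-- Two continuous logarithms of the same function on a preconnected set differ by a constant. -/
theorem sub_eq_sub_of_exp_eqOn {S : Set ℂ} (hS : IsPreconnected S) {u v : ℂ → ℂ}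
    (hu : ContinuousOn u S) (hv : ContinuousOn v S)
    (h : ∀ z ∈ S, Complex.exp (u z) = Complex.exp (v z)) {a b : ℂ} (ha : a ∈ S) (hb : b ∈ S) :
    u b - u a = v b - v a := by
  have := Complex.isCoveringMap_exp.constOn_of_comp hS (hu.sub hv)
    (fun x hx y hy => Subtype.ext (by simp [Complex.exp_sub, h x hx, h y hy, Complex.exp_ne_zero]))
    hb ha
  simp only [Pi.sub_apply] at this
  linear_combination this

/-- The exponential covers the punctured plane and `ℂ` is simply connected, so `K` lifts. -/
theorem exists_continuous_log {K : ℂ → ℂ} (hK : Continuous K) (h0 : ∀ z, K z ≠ 0) :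
    ∃ μ : ℂ → ℂ, Continuous μ ∧ ∀ z, K z = Complex.exp (μ z) := by
  obtain ⟨F, ⟨-, hF⟩, -⟩ := Complex.isCoveringMapOn_exp.existsUnique_continuousMap_lifts
    (⟨K, hK⟩ : C(ℂ, ℂ)) (a₀ := 0) (e₀ := Complex.log (K 0))
    (by simpa using Complex.exp_log (h0 0)) (fun a => by simpa using h0 a)
  exact ⟨F, F.continuous, fun z => (congrFun hF z).symm⟩

/-- There is no continuous logarithm of `z - p` on a circle around `p`. -/
theorem no_log_on_circle (p : ℂ) {r : ℝ} (hr : 0 < r) {μ : ℂ → ℂ} (hμ : Continuous μ)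
    (h : ∀ z, dist z p = r → z - p = Complex.exp (μ z)) : False := by
  let g : ℝ → ℂ := fun t => μ (circleMap p r t)
  let k : ℝ → ℂ := fun t => Complex.log r + t * Complex.I
  have hg : Continuous g := hμ.comp (continuous_circleMap p r)
  have hk : Continuous k := by fun_prop
  have hexp : ∀ t, Complex.exp (g t) = Complex.exp (k t) := by
    intro t
    have h1 := h (circleMap p r t) (by simp [circleMap, dist_eq_norm, abs_of_pos hr])
    rw [← h1, Complex.exp_add, Complex.exp_log (by exact_mod_cast hr.ne')]
    simp [circleMap]
  -- Over one period `g` returns to its value while `k` gains `2πi`, so their difference cannot be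
  -- constant.
  have hconst : ∀ t, g t - k t = g 0 - k 0 := by
    intro t
    have := Complex.isCoveringMap_exp.const_of_comp (g := fun t => g t - k t) (hg.sub hk)
      (fun a b => Subtype.ext (by simp [Complex.exp_sub, hexp, Complex.exp_ne_zero])) t 0
    exact this
  have h2 := hconst (2 * Real.pi)
  have h3 : g (2 * Real.pi) = g 0 := by
    simp only [g]; congr 1; simpa using periodic_circleMap p r 0
  rw [h3] at h2
  have : (2 * Real.pi * Complex.I : ℂ) = 0 := by
    simp only [k] at h2; push_cast at h2; linear_combination (-1 : ℂ) * h2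
  simp [Real.pi_ne_zero] at this

/-- If `U` is bounded and `p ∈ U`, then on the frontier of `U` the function `z - p` is not
the product of an exponential with a function that has a zero-free continuous extension to `U`. -/
theorem no_log_on_frontier {U : Set ℂ} (hb : Bornology.IsBounded U) {p : ℂ}
    (hp : p ∈ U) {h : ℂ → ℂ} (hh : Continuous h) (h0 : ∀ z ∈ closure U, h z ≠ 0)
    {l : ℂ → ℂ} (hl : ContinuousOn l (frontier U))
    (heq : ∀ z ∈ frontier U, z - p = h z * Complex.exp (l z)) : False := by
  classical
  -- Tietze extension makes the first branch of `K` continuous on the whole plane. The two branches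
  -- agree on the frontier, and `z - p` vanishes only at `p ∈ U`, where the other branch is used;
  -- hence `K` has a global logarithm, which is impossible on a large circle.
  obtain ⟨l', hl'⟩ := ContinuousMap.exists_restrict_eq (isClosed_frontier (s := U))
    ⟨(frontier U).domRestrict l, hl.domRestrict⟩
  have hl'' : ∀ z ∈ frontier U, l' z = l z := fun z hz => by
    simpa using congrArg (fun f => f ⟨z, hz⟩) hl'
  let K : ℂ → ℂ := U.piecewise (fun z => h z * Complex.exp (l' z)) (fun z => z - p)
  have hK : Continuous K := by
    refine Continuous.piecewise (fun z hz => ?_) (by fun_prop) (by fun_prop)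
    rw [hl'' z hz, heq z hz]
  obtain ⟨μ, hμ, hKμ⟩ := exists_continuous_log hK (fun z => by
    by_cases hz : z ∈ U
    · simpa [K, hz] using h0 z (subset_closure hz)
    · simp only [K, hz, not_false_eq_true, piecewise_eq_of_notMem]
      exact sub_ne_zero.2 fun e => hz (e ▸ hp))
  obtain ⟨r, hr, hUr⟩ := hb.subset_ball_lt 0 p
  refine no_log_on_circle p hr hμ fun z hz => ?_
  have hzU : z ∉ U := fun hzU => by have := hUr hzU; rw [mem_ball] at this; linarith
  rw [← hKμ z]; simp [K, hzU]

/-- On the ball, `(z - p) / (a - p)` stays within distance `1` of `1`, where the principal logarithm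
is continuous. -/
theorem exists_log_on_ball {a p : ℂ} {ε : ℝ} (hp : ε ≤ dist p a) :
    ∃ l : ℂ → ℂ, ContinuousOn l (ball a ε) ∧ ∀ z ∈ ball a ε, z - p = Complex.exp (l z) := by
  rcases le_or_gt ε 0 with h | hε
  · exact ⟨0, by simp [ball_eq_empty.2 h], by simp [ball_eq_empty.2 h]⟩
  have hap : a - p ≠ 0 := by
    rw [← norm_pos_iff, ← dist_eq_norm, dist_comm]; linarith
  have hs : ∀ z ∈ ball a ε, 1 + (z - a) / (a - p) ∈ Complex.slitPlane := fun z hz => by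
    refine Complex.mem_slitPlane_of_norm_lt_one ?_
    rw [norm_div, div_lt_one (norm_pos_iff.2 hap), ← dist_eq_norm, ← dist_eq_norm, dist_comm a p]
    exact (mem_ball.1 hz).trans_le hp
  refine ⟨fun z => Complex.log (1 + (z - a) / (a - p)) + Complex.log (a - p), ?_, fun z hz => ?_⟩
  · exact (ContinuousOn.clog (by fun_prop) hs).add continuousOn_const
  · rw [Complex.exp_add, Complex.exp_log (Complex.slitPlane_ne_zero (hs z hz)), Complex.exp_log hap]
    field_simp; ring

/-- Having a logarithm of `(z - p) / (z - q)` off `G` is an equivalence relation between `p` and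
`q`. It holds for nearby points because the quotient is then close to `1`, so connectedness of `G`
spreads it to all pairs. -/
theorem exists_log_quotient_compl {G : Set ℂ} (hG : IsOpen G) (hc : IsPreconnected G) {p q : ℂ}
    (hp : p ∈ G) (hq : q ∈ G) :
    ∃ l : ℂ → ℂ, ContinuousOn l Gᶜ ∧ ∀ z ∈ Gᶜ, z - p = (z - q) * Complex.exp (l z) := by
  refine hc.induction₂ (fun p q => ∃ l : ℂ → ℂ, ContinuousOn l Gᶜ ∧
    ∀ z ∈ Gᶜ, z - p = (z - q) * Complex.exp (l z)) (fun x hx => ?_) ?_ ?_ hp hq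
  · obtain ⟨r, hr, hrG⟩ := Metric.isOpen_iff.1 hG x hx
    filter_upwards [mem_nhdsWithin_of_mem_nhds (ball_mem_nhds x hr)] with y hy
    have hx0 : ∀ z ∈ Gᶜ, z - x ≠ 0 := fun z hz e => hz (sub_eq_zero.1 e ▸ hx)
    have hy0 : ∀ z ∈ Gᶜ, z - y ≠ 0 := fun z hz e => hz (hrG (sub_eq_zero.1 e ▸ hy))
    have hs : ∀ z ∈ Gᶜ, 1 + (x - y) / (z - x) ∈ Complex.slitPlane := fun z hz => by
      refine Complex.mem_slitPlane_of_norm_lt_one ?_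
      rw [norm_div, div_lt_one (norm_pos_iff.2 (hx0 z hz)), ← dist_eq_norm, ← dist_eq_norm,
        dist_comm]
      refine (mem_ball.1 hy).trans_le (not_lt.1 fun h => hz (hrG h))
    refine ⟨fun z => - Complex.log (1 + (x - y) / (z - x)), ?_, fun z hz => ?_⟩
    · exact (ContinuousOn.clog (continuousOn_const.add (continuousOn_const.div (by fun_prop) hx0))
        hs).neg
    · rw [Complex.exp_neg, Complex.exp_log (Complex.slitPlane_ne_zero (hs z hz))]
      have h1 : 1 + (x - y) / (z - x) = (z - y) / (z - x) := by field_simp [hx0 z hz]; ring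
      rw [h1, inv_div, mul_div_cancel₀ _ (hy0 z hz)]
  · rintro x y z - - - ⟨l, hl, h⟩ ⟨m, hm, h'⟩
    refine ⟨fun w => m w + l w, hm.add hl, fun w hw => ?_⟩
    rw [h w hw, h' w hw, Complex.exp_add, mul_assoc]
  · rintro x y - - ⟨l, hl, h⟩
    refine ⟨fun w => - l w, hl.neg, fun w hw => ?_⟩
    rw [h w hw, mul_assoc, ← Complex.exp_add]; simp

/-! ### Uniform boundedness of the domains -/

/-- For large `n`, the frontier of the limit domain is uniformly close to the complements. -/
theorem CaratheodoryConvergence.eventually_frontier_near {Λ : ℕ → Set ℂ} {L : Set ℂ}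
    (h : CaratheodoryConvergence Λ L) (hΛ : ∀ n, IsOpen (Λ n)) (hb : Bornology.IsBounded L)
    {η : ℝ} (hη : 0 < η) :
    ∀ᶠ n in atTop, ∀ p ∈ frontier L, ∃ s ∈ (Λ n)ᶜ, dist p s < η := by
  have hcpt : IsCompact (frontier L) :=
    (hb.isCompact_closure).of_isClosed_subset isClosed_frontier frontier_subset_closure
  obtain ⟨t, htL, htf, hcov⟩ := hcpt.finite_cover_balls (half_pos hη)
  have h1 : ∀ᶠ n in atTop, ∀ x ∈ t, ∃ s ∈ (Λ n)ᶜ, dist x s < η / 2 := by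
    rw [eventually_all_finite htf]
    intro x hx
    obtain ⟨q, hq, hqx⟩ := h.frontier_approx x (htL hx)
    filter_upwards [hqx (ball_mem_nhds x (half_pos hη))] with n hn
    refine ⟨q n, fun hqn => ?_, by rw [dist_comm]; exact hn⟩
    exact (hΛ n).inter_frontier_eq.subset ⟨hqn, hq n⟩
  filter_upwards [h1] with n hn p hp
  obtain ⟨x, hx, hpx⟩ := mem_iUnion₂.1 (hcov hp)
  obtain ⟨s, hs, hxs⟩ := hn x hx
  exact ⟨s, hs, by have := dist_triangle p x s; rw [mem_ball] at hpx; linarith⟩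

/-- Under uniform local connectedness of the complements, Carathéodory convergence of domains to a
bounded domain forces the domains to be uniformly bounded eventually. -/
theorem CaratheodoryConvergence.eventually_subset_ball {Λ : ℕ → Set ℂ} {L : Set ℂ}
    (h : CaratheodoryConvergence Λ L) (hΛ : ∀ n, IsOpen (Λ n)) (hΛc : ∀ n, IsPreconnected (Λ n))
    (hL : IsOpen L) (hb : Bornology.IsBounded L) {q : ℂ} (hq : q ∈ L)
    (hulc : UniformlyLocallyConnected fun n => (Λ n)ᶜ) :
    ∃ R : ℝ, ∀ᶠ n in atTop, Λ n ⊆ ball q R := by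
  obtain ⟨r, hr, hrL⟩ := Metric.isOpen_iff.1 hL q hq
  obtain ⟨R₀, hR₀, hLR⟩ := hb.subset_ball_lt 0 q
  have hfr : ∀ p ∈ frontier L, r ≤ dist p q := fun p hp => not_lt.1 fun hlt =>
    hL.inter_frontier_eq.subset ⟨hrL hlt, hp⟩
  have hfR : ∀ p ∈ frontier L, dist p q ≤ R₀ := fun p hp =>
    closure_ball_subset_closedBall (closure_mono hLR (frontier_subset_closure hp))
  obtain ⟨δ, hδ, hδB⟩ := hulc.2 (r / 4) (by positivity)
  -- With `δ / 4`, three short hops `s p → p → p' → s p'` stay below `δ`, so a continuum in the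
  -- complement joins the ends. With `r / 8`, all of this stays in a disc of radius `r / 2` around
  -- `s p`, which misses `q`.
  have hη : 0 < min (δ / 4) (r / 8) := by positivity
  obtain ⟨V, hV, hVΛ⟩ := h.eventually_nhds_subset q hq
  refine ⟨R₀ + r, ?_⟩
  filter_upwards [h.eventually_frontier_near hΛ hb hη, hVΛ] with n hn hVn w hw
  by_contra hwR
  have hqn : q ∈ Λ n := hVn (mem_of_mem_nhds hV)
  obtain ⟨l₁, hl₁, hl₁e⟩ := exists_log_quotient_compl (hΛ n) (hΛc n) hqn hw
  obtain ⟨l₂, hl₂, hl₂e⟩ := exists_log_on_ball (a := q) (p := w) (not_lt.1 hwR)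
  choose! s hs hsd using hn
  have hsd1 : ∀ p ∈ frontier L, dist p (s p) < δ / 4 := fun p hp =>
    (hsd p hp).trans_le (min_le_left _ _)
  have hsd2 : ∀ p ∈ frontier L, dist p (s p) < r / 8 := fun p hp =>
    (hsd p hp).trans_le (min_le_right _ _)
  have hm : ∀ p, ∃ m : ℂ → ℂ, p ∈ frontier L → ContinuousOn m (ball (s p) (r / 2)) ∧
      ∀ z ∈ ball (s p) (r / 2), z - q = Complex.exp (m z) := fun p => by
    by_cases hp : p ∈ frontier L
    · obtain ⟨m, hm⟩ := exists_log_on_ball (a := s p) (p := q) (ε := r / 2) (by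
        have := dist_triangle_right p q (s p); have := hfr p hp; have := hsd2 p hp; linarith)
      exact ⟨m, fun _ => hm⟩
    · exact ⟨0, fun h => absurd h hp⟩
  choose m hm using hm
  -- A point `w ∈ Λ n` far from `q` yields a logarithm of `z - q` on the part of the complement in
  -- the large disc: add the logarithms of `(z - q) / (z - w)` and of `z - w`. It remains to carry
  -- it over to the frontier of `L`, where none can exist.
  set l : ℂ → ℂ := fun z => l₂ z + l₁ z with hl
  have hlc : ContinuousOn l ((Λ n)ᶜ ∩ ball q (R₀ + r)) :=
    (hl₂.mono inter_subset_right).add (hl₁.mono inter_subset_left)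
  have hle : ∀ z ∈ (Λ n)ᶜ ∩ ball q (R₀ + r), z - q = Complex.exp (l z) := fun z hz => by
    rw [hl₁e z hz.1, hl₂e z hz.2, hl, Complex.exp_add]
  have hsR : ∀ p ∈ frontier L, ball (s p) (r / 2) ⊆ ball q (R₀ + r) := fun p hp => by
    refine ball_subset_ball' ?_
    have := dist_triangle_left (s p) q p; have := hfR p hp; have := hsd2 p hp; linarith
  have hss : ∀ p ∈ frontier L, s p ∈ ball (s p) (r / 2) := fun p hp =>
    mem_ball_self (by positivity)
  -- The value of `l` at the nearby complement point `s p` is continued to `p` along the local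
  -- branch `m p`. The choice of `s p` is arbitrary; continuity comes from `hloc`, where the
  -- continuum `B` shows that neighbouring choices give the same branch.
  set μ : ℂ → ℂ := fun p => l (s p) + (m p p - m p (s p)) with hμ
  have hpb : ∀ p ∈ frontier L, p ∈ ball (s p) (r / 2) := fun p hp => by
    have := hsd2 p hp; rw [mem_ball]; linarith
  have hloc : ∀ p ∈ frontier L, ∀ p' ∈ frontier L, dist p' p < min (δ / 4) (r / 8) →
      μ p' = l (s p) + (m p p' - m p (s p)) := by
    intro p hp p' hp' hpp
    have hpp1 := hpp.trans_le (min_le_left _ _)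
    have hpp2 := hpp.trans_le (min_le_right _ _)
    have d1 := hsd1 p hp
    have d2 := hsd1 p' hp'
    have e1 := hsd2 p hp
    have e2 := hsd2 p' hp'
    have t1 := dist_triangle (s p) p (s p')
    have t2 := dist_triangle p p' (s p')
    have t3 := dist_triangle p' p (s p)
    rw [dist_comm (s p) p, dist_comm p p'] at *
    obtain ⟨B, hBc, hBconn, haB, hbB, hBsub, hBd⟩ :=
      hδB n (s p) (hs p hp) (s p') (hs p' hp') (by linarith)
    have hBball : B ⊆ ball (s p) (r / 2) := fun z hz => by
      have := dist_le_diam_of_mem hBc.isBounded hz haB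
      rw [mem_ball]; linarith
    have k1 := sub_eq_sub_of_exp_eqOn hBconn.isPreconnected (u := l) (v := m p)
      (hlc.mono fun z hz => ⟨hBsub hz, hsR p hp (hBball hz)⟩) ((hm p hp).1.mono hBball)
      (fun z hz => by rw [← hle z ⟨hBsub hz, hsR p hp (hBball hz)⟩, (hm p hp).2 z (hBball hz)])
      haB hbB
    have k2 := sub_eq_sub_of_exp_eqOn
      (S := ball (s p) (r / 2) ∩ ball (s p') (r / 2)) (u := m p') (v := m p)
      ((convex_ball _ _).inter (convex_ball _ _)).isPreconnected
      ((hm p' hp').1.mono inter_subset_right) ((hm p hp).1.mono inter_subset_left)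
      (fun z hz => by rw [← (hm p' hp').2 z hz.2, (hm p hp).2 z hz.1])
      (a := s p') (b := p') ⟨hBball hbB, hss p' hp'⟩
      ⟨by rw [mem_ball]; linarith, hpb p' hp'⟩
    simp only [hμ]
    linear_combination k1 + k2
  refine no_log_on_frontier hb hq (h := 1) continuous_const (by simp) (l := μ) ?_ ?_
  · intro p hp
    have hcont : ContinuousAt (fun p' => l (s p) + (m p p' - m p (s p))) p :=
      continuousAt_const.add ((((hm p hp).1.continuousAt
        (isOpen_ball.mem_nhds (hpb p hp)))).sub continuousAt_const)
    refine hcont.continuousWithinAt.congr_of_eventuallyEq ?_ (hloc p hp p hp (by simpa using hη))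
    filter_upwards [self_mem_nhdsWithin, mem_nhdsWithin_of_mem_nhds (ball_mem_nhds p hη)]
      with p' hp' hd
    exact hloc p hp p' hp' hd
  · intro p hp
    simp only [hμ, Pi.one_apply, one_mul]
    rw [Complex.exp_add, Complex.exp_sub, ← hle _ ⟨hs p hp, hsR p hp (hss p hp)⟩,
      ← (hm p hp).2 _ (hpb p hp), ← (hm p hp).2 _ (hss p hp), mul_div_cancel₀]
    rw [(hm p hp).2 _ (hss p hp)]
    exact Complex.exp_ne_zero _

/-! ### Holomorphic inverses and the length-area method -/

/-- Zeros of the derivative are isolated, since `e` is injective and hence nowhere locally constant.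
Away from them the inverse function theorem applies; at the remaining points the continuous inverse
has a removable singularity. -/
theorem OpenPartialHomeomorph.differentiableOn_symm_of_complex {e : OpenPartialHomeomorph ℂ ℂ}
    (he : DifferentiableOn ℂ e e.source) : DifferentiableOn ℂ e.symm e.target := by
  intro w hw
  have hz : e.symm w ∈ e.source := e.map_target hw
  have han : ∀ z ∈ e.source, AnalyticAt ℂ e z := fun z hz =>
    he.analyticAt (e.open_source.mem_nhds hz)
  have hcont : ContinuousAt e.symm w := e.continuousAt_symm hw
  have hne : ∀ᶠ z in 𝓝[≠] e.symm w, deriv e z ≠ 0 := by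
    refine (han _ hz).deriv.eventually_eq_zero_or_eventually_ne_zero.resolve_left fun h0 => ?_
    obtain ⟨r, hr, hball⟩ := Metric.mem_nhds_iff.1
      (inter_mem h0 (e.open_source.mem_nhds hz))
    have hconst : ∀ z ∈ ball (e.symm w) r, e z = e (e.symm w) := fun z hz' =>
      isOpen_ball.is_const_of_deriv_eq_zero (convex_ball _ _).isPreconnected
        (he.mono fun y hy => (hball hy).2) (fun y hy => (hball hy).1) hz' (mem_ball_self hr)
    obtain ⟨y, hy, hyne⟩ := Filter.nonempty_of_mem (inter_mem_nhdsWithin {e.symm w}ᶜ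
      (ball_mem_nhds (e.symm w) hr))
    exact hy (e.injOn (hball hyne).2 hz (hconst y hyne))
  refine (Complex.analyticAt_of_differentiable_on_punctured_nhds_of_continuousAt ?_
    hcont).differentiableAt.differentiableWithinAt
  have hT : Tendsto e.symm (𝓝[≠] w) (𝓝[≠] e.symm w) := by
    refine tendsto_nhdsWithin_iff.2 ⟨hcont.tendsto.mono_left nhdsWithin_le_nhds, ?_⟩
    filter_upwards [self_mem_nhdsWithin, mem_nhdsWithin_of_mem_nhds (e.open_target.mem_nhds hw)]
      with v hv hvt heq
    exact hv (e.symm.injOn hvt hw heq)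
  filter_upwards [hT.eventually hne, mem_nhdsWithin_of_mem_nhds (e.open_target.mem_nhds hw)]
    with v hv hvt
  exact (e.hasDerivAt_symm hvt hv (han _ (e.map_target hvt)).differentiableAt.hasDerivAt
    ).differentiableAt

/-- The area of the image of an injective holomorphic map. -/
theorem lintegral_enorm_deriv_sq {f : ℂ → ℂ} {U : Set ℂ} (hU : IsOpen U)
    (hf : DifferentiableOn ℂ f U) (hinj : InjOn f U) :
    ∫⁻ z in U, ‖deriv f z‖ₑ ^ 2 = volume (f '' U) := by
  rw [← lintegral_abs_det_fderiv_eq_addHaar_image volume hU.measurableSet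
    (f' := fun z => (fderiv ℂ f z).restrictScalars ℝ) (fun z hz =>
      ((hf.differentiableAt (hU.mem_nhds hz)).hasFDerivAt.restrictScalars ℝ).hasFDerivWithinAt) hinj]
  refine lintegral_congr fun z => ?_
  have : ((fderiv ℂ f z).restrictScalars ℝ).det = ‖deriv f z‖ ^ 2 := by
    rw [ContinuousLinearMap.det]
    have h1 : (((fderiv ℂ f z).restrictScalars ℝ : ℂ →L[ℝ] ℂ) : ℂ →ₗ[ℝ] ℂ) =
      ((fderiv ℂ f z : ℂ →L[ℂ] ℂ) : ℂ →ₗ[ℂ] ℂ).restrictScalars ℝ := rfl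
    rw [h1, LinearMap.det_restrictScalars, Algebra.norm_complex_apply, Complex.normSq_eq_norm_sq]
    simp [LinearMap.det_ring]
  rw [this, abs_of_nonneg (by positivity), ENNReal.ofReal_pow (norm_nonneg _), ofReal_norm]

theorem sq_lintegral_le {α : Type*} [MeasurableSpace α] (μ : Measure α) {g : α → ℝ≥0∞}
    (hg : AEMeasurable g μ) : (∫⁻ x, g x ∂μ) ^ 2 ≤ μ univ * ∫⁻ x, g x ^ 2 ∂μ := by
  have := ENNReal.lintegral_mul_le_Lp_mul_Lq μ Real.HolderConjugate.two_two
    (f := fun _ => 1) (g := g) aemeasurable_const hg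
  simp only [Pi.mul_apply, one_mul, lintegral_const, ENNReal.rpow_two, one_pow] at this
  calc _ ≤ ((μ univ) ^ (1 / 2 : ℝ) * (∫⁻ x, g x ^ 2 ∂μ) ^ (1 / 2 : ℝ)) ^ 2 := by gcongr
    _ = _ := by
      rw [mul_pow, ← ENNReal.rpow_two, ← ENNReal.rpow_two, ← ENNReal.rpow_mul, ← ENNReal.rpow_mul]
      norm_num

/-- Polar coordinates centred at `-1`, the boundary point to which all others are later rotated. -/
theorem lintegral_polar_neg_one (g : ℂ → ℝ≥0∞) (hg : Measurable g) :
    ∫⁻ ρ in Ioi (0 : ℝ), ENNReal.ofReal ρ *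
      ∫⁻ θ in Ioo (-Real.pi) Real.pi, g (circleMap (-1) ρ θ) = ∫⁻ z, g z := by
  rw [← lintegral_sub_right_eq_self g 1, ← Complex.lintegral_comp_polarCoord_symm,
    polarCoord_target, Measure.volume_eq_prod, ← Measure.prod_restrict]
  have hc : ∀ p : ℝ × ℝ, Complex.polarCoord.symm p - 1 = circleMap (-1) p.1 p.2 := fun p => by
    rw [Complex.polarCoord_symm_apply, circleMap, Complex.exp_mul_I]; push_cast; ring
  have hm : Measurable fun p : ℝ × ℝ => g (circleMap (-1) p.1 p.2) :=
    hg.comp (by unfold circleMap; fun_prop)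
  simp_rw [hc]
  rw [lintegral_prod _ (by fun_prop)]
  refine lintegral_congr fun ρ => ?_
  simp only [smul_eq_mul]
  exact (lintegral_const_mul _ (hg.comp (measurable_circleMap (-1) ρ))).symm

/-- The length-area estimate: some circular arc around the boundary point `-1` has a short image. -/
theorem exists_short_arc {A : ℝ≥0∞} (hA : A ≠ ∞) {η : ℝ} (hη : 0 < η) :
    ∃ δ ∈ Ioo (0 : ℝ) 1, ∀ f : ℂ → ℂ, DifferentiableOn ℂ f (ball 0 1) → InjOn f (ball 0 1) →
      volume (f '' ball 0 1) ≤ A → ∃ ρ ∈ Ioo δ 1, ENNReal.ofReal ρ *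
        ∫⁻ θ in Ioo (-Real.pi) Real.pi,
          (ball (0 : ℂ) 1).indicator (fun z => ‖deriv f z‖ₑ) (circleMap (-1) ρ θ)
          < ENNReal.ofReal η := by
  -- If every arc had image length at least `η`, Cauchy–Schwarz in the angle would give each radius
  -- `ρ` an area density of at least `c / ρ`. The choice of `δ` makes the integral of `c / ρ` over
  -- `(δ, 1)` equal to `A + 1`, more than the available area.
  set c : ℝ := η ^ 2 / (2 * Real.pi) with hc
  have hcpos : 0 < c := by positivity
  set δ : ℝ := Real.exp (-((A.toReal + 1) / c)) with hδ
  have hδ0 : 0 < δ := Real.exp_pos _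
  have hδ1 : δ < 1 := Real.exp_lt_one_iff.2 (neg_neg_of_pos (by have := A.toReal_nonneg; positivity))
  refine ⟨δ, ⟨hδ0, hδ1⟩, fun f hf hinj hvol => ?_⟩
  by_contra! hcon
  set g : ℂ → ℝ≥0∞ := (ball (0 : ℂ) 1).indicator (fun z => ‖deriv f z‖ₑ) with hg
  have hgm : Measurable g := (measurable_deriv f).enorm.indicator measurableSet_ball
  have harea : ∫⁻ z, g z ^ 2 ≤ A := by
    refine le_trans (le_of_eq ?_) hvol
    rw [← lintegral_enorm_deriv_sq isOpen_ball hf hinj, ← lintegral_indicator measurableSet_ball]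
    refine lintegral_congr fun z => ?_
    by_cases hz : z ∈ ball (0 : ℂ) 1 <;> simp [hg, indicator, hz]
  rw [← lintegral_polar_neg_one _ (hgm.pow_const 2)] at harea
  have hpt : ∀ ρ ∈ Ioo δ 1, ENNReal.ofReal (c * ρ⁻¹) ≤ ENNReal.ofReal ρ *
      ∫⁻ θ in Ioo (-Real.pi) Real.pi, g (circleMap (-1) ρ θ) ^ 2 := by
    intro ρ hρ
    have hρ0 : 0 < ρ := hδ0.trans hρ.1
    have h1 := sq_lintegral_le (volume.restrict (Ioo (-Real.pi) Real.pi))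
      (g := fun θ => g (circleMap (-1) ρ θ))
      (hgm.comp (measurable_circleMap (-1) ρ)).aemeasurable
    have h2 : (ENNReal.ofReal η) ^ 2 ≤ ENNReal.ofReal ρ ^ 2 * (ENNReal.ofReal (2 * Real.pi) *
        ∫⁻ θ in Ioo (-Real.pi) Real.pi, g (circleMap (-1) ρ θ) ^ 2) := by
      calc _ ≤ _ := pow_le_pow_left' (hcon ρ hρ) 2
        _ ≤ _ := by
          rw [mul_pow]; gcongr
          refine h1.trans_eq ?_
          rw [Measure.restrict_apply_univ, Real.volume_Ioo]; ring_nf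
    generalize (∫⁻ θ in Ioo (-Real.pi) Real.pi, g (circleMap (-1) ρ θ) ^ 2) = I at h2 ⊢
    have h3 : c * ρ⁻¹ = (2 * Real.pi * ρ)⁻¹ * η ^ 2 := by rw [hc]; field_simp
    rw [h3, ENNReal.ofReal_mul (by positivity), ENNReal.ofReal_pow hη.le]
    refine (mul_le_mul_right h2 _).trans_eq ?_
    rw [← ENNReal.ofReal_pow hρ0.le, ← mul_assoc, ← mul_assoc,
      ← ENNReal.ofReal_mul (by positivity), ← ENNReal.ofReal_mul (by positivity)]
    congr 2; field_simp
  have hlog : ∫⁻ ρ in Ioo δ 1, ENNReal.ofReal (c * ρ⁻¹) = ENNReal.ofReal (A.toReal + 1) := by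
    have hii : IntervalIntegrable (fun ρ : ℝ => c * ρ⁻¹) volume δ 1 :=
      (intervalIntegral.intervalIntegrable_inv (fun x hx => by
        rw [uIcc_of_le hδ1.le] at hx; exact (hδ0.trans_le hx.1).ne') continuousOn_id).const_mul c
    rw [restrict_Ioo_eq_restrict_Ioc, ← ofReal_integral_eq_lintegral_ofReal
      ((intervalIntegrable_iff_integrableOn_Ioc_of_le hδ1.le).1 hii), 
      ← intervalIntegral.integral_of_le hδ1.le, intervalIntegral.integral_const_mul,
      integral_inv_of_pos hδ0 one_pos, one_div, Real.log_inv, hδ, Real.log_exp]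
    · congr 1; field_simp
    · refine (ae_restrict_iff' measurableSet_Ioc).2 (Eventually.of_forall fun ρ hρ => ?_)
      have := hδ0.trans hρ.1
      simp only [Pi.zero_apply]; positivity
  have hfinal : ENNReal.ofReal (A.toReal + 1) ≤ A := by
    rw [← hlog]
    refine (setLIntegral_mono' measurableSet_Ioo hpt).trans (le_trans ?_ harea)
    exact lintegral_mono_set fun ρ hρ => hδ0.trans hρ.1
  rw [← ENNReal.ofReal_toReal hA, ENNReal.ofReal_le_ofReal_iff ENNReal.toReal_nonneg] at hfinal
  rw [ENNReal.toReal_ofReal ENNReal.toReal_nonneg] at hfinal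
  linarith

/-! ### Crosscuts and oscillation at the unit circle -/

/-- A crosscut argument in the spirit of Janiszewski's theorem: if the part of the frontier of
`U ⊆ G` inside `G` lies on a set `Q` whose end points are joined by a continuum `B` outside `G`, and
`B ∪ Q` is contained in a disc that does not contain a point `q ∈ G` off `closure U`, then `U` is
contained in that disc. -/
theorem subset_ball_of_crosscut {G U B Q : Set ℂ} (hG : IsOpen G) (hGc : IsPreconnected G)
    (hUG : U ⊆ G) (hb : Bornology.IsBounded U) {a b q : ℂ} {ε : ℝ}
    (hB : IsPreconnected B) (hBG : B ⊆ Gᶜ) (haB : a ∈ B) (hbB : b ∈ B) (hBε : B ⊆ ball a ε)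
    (hQ : IsClosed Q) (hQε : Q ⊆ ball a ε) (hQG : Q \ {a, b} ⊆ G)
    (hfr : frontier U ⊆ Gᶜ ∪ Q) (hq : q ∈ G) (hqU : q ∉ closure U) (hqa : ε ≤ dist q a) :
    U ⊆ ball a ε := by
  classical
  intro p hp
  by_contra hpa
  obtain ⟨l, hl, hle⟩ := exists_log_quotient_compl hG hGc (hUG hp) hq
  obtain ⟨lp, hlp, hlpe⟩ := exists_log_on_ball (not_lt.1 hpa)
  obtain ⟨lq, hlq, hlqe⟩ := exists_log_on_ball hqa
  set m : ℂ → ℂ := fun z => lp z - lq z with hm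
  have hmc : ContinuousOn m (ball a ε) := hlp.sub hlq
  have hme : ∀ z ∈ ball a ε, z - p = (z - q) * Complex.exp (m z) := fun z hz => by
    rw [hlpe z hz, hlqe z hz, hm, ← Complex.exp_add]; congr 1; ring
  have hqz : ∀ z ∈ Gᶜ, z - q ≠ 0 := fun z hz h => hz (sub_eq_zero.1 h ▸ hq)
  -- On `B` both `l` and `m` are logarithms of `(z - p) / (z - q)`. Connectedness of `B` makes them
  -- differ by the same constant at `a` and `b`, so one shift of `m` matches `l` at both ends of
  -- `Q`, the only points where `Q` can meet the complement of `G`.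
  have hab := sub_eq_sub_of_exp_eqOn hB (hl.mono hBG) (hmc.mono hBε) (fun z hz => by
    have h1 := hle z (hBG hz)
    rw [hme z (hBε hz)] at h1
    exact (mul_left_cancel₀ (hqz z (hBG hz)) h1).symm) haB hbB
  set k : ℂ → ℂ := Gᶜ.piecewise l (fun z => m z + (l a - m a)) with hk
  have hkm : EqOn k (fun z => m z + (l a - m a)) Q := fun z hz => by
    by_cases hzG : z ∈ Gᶜ
    · have : z = a ∨ z = b := by by_contra h; exact hzG (hQG ⟨hz, by simpa using h⟩)
      simp only [hk, piecewise_eq_of_mem _ _ _ hzG]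
      rcases this with rfl | rfl
      · ring
      · linear_combination hab
    · simp only [hk, piecewise_eq_of_notMem _ _ _ hzG]
  have hkl : EqOn k l Gᶜ := piecewise_eqOn _ _ _
  have hexp : Complex.exp (l a - m a) = 1 := by
    have h1 := hle a (hBG haB)
    rw [hme a (hBε haB)] at h1
    rw [Complex.exp_sub, ← mul_left_cancel₀ (hqz a (hBG haB)) h1, div_self (Complex.exp_ne_zero _)]
  refine no_log_on_frontier hb hp (h := fun z => z - q) (by fun_prop)
    (fun z hz h => hqU (sub_eq_zero.1 h ▸ hz)) (l := k) ?_ fun z hz => ?_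
  · refine ContinuousOn.mono ?_ hfr
    exact (hl.congr hkl).union_of_isClosed
      (((hmc.mono hQε).add continuousOn_const).congr hkm) hG.isClosed_compl hQ
  · rcases hfr hz with hzG | hzQ
    · rw [hkl hzG, hle z hzG]
    · rw [hkm hzQ, Complex.exp_add, hexp, mul_one, hme z (hQε hzQ)]

theorem sq_norm_circleMap_neg_one (ρ θ : ℝ) :
    ‖circleMap (-1) ρ θ‖ ^ 2 = 1 - 2 * ρ * Real.cos θ + ρ ^ 2 := by
  have h : circleMap (-1) ρ θ = ⟨-1 + ρ * Real.cos θ, ρ * Real.sin θ⟩ := by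
    apply Complex.ext <;> simp [circleMap, Complex.exp_ofReal_mul_I_re, Complex.exp_ofReal_mul_I_im]
  rw [h, ← Complex.normSq_eq_norm_sq, Complex.normSq_mk]
  linear_combination ρ ^ 2 * Real.sin_sq_add_cos_sq θ

theorem circleMap_neg_one_mem_ball_iff {ρ θ : ℝ} (hρ : 0 < ρ) :
    circleMap (-1) ρ θ ∈ ball (0 : ℂ) 1 ↔ ρ / 2 < Real.cos θ := by
  rw [mem_ball_zero_iff, ← sq_lt_one_iff₀ (norm_nonneg _), sq_norm_circleMap_neg_one]
  constructor <;> intro h <;> nlinarith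

/-- If the image of a circular arc around `-1` in the unit disc under a conformal map is short, then
its closure is a crosscut of the image domain. -/
theorem exists_crosscut {e : OpenPartialHomeomorph ℂ ℂ} (hs : e.source = ball 0 1)
    (he : DifferentiableOn ℂ e (ball 0 1)) {ρ η : ℝ} (hρ : ρ ∈ Ioo (0 : ℝ) 1)
    (h : ENNReal.ofReal ρ * ∫⁻ θ in Ioo (-Real.pi) Real.pi,
      (ball (0 : ℂ) 1).indicator (fun z => ‖deriv e z‖ₑ) (circleMap (-1) ρ θ)
      < ENNReal.ofReal η) :
    ∃ (Q : Set ℂ) (a b : ℂ), IsCompact Q ∧ a ∈ Q ∧ b ∈ Q ∧ a ∉ e.target ∧ b ∉ e.target ∧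
      Q ⊆ ball a η ∧ Q \ {a, b} ⊆ e.target ∧
      ∀ z ∈ ball (0 : ℂ) 1, dist z (-1) = ρ → e z ∈ Q := by
  obtain ⟨hρ0, hρ1⟩ := hρ
  set α : ℝ := Real.arccos (ρ / 2) with hα
  have hα0 : 0 < α := Real.arccos_pos.2 (by linarith)
  have hαπ : α < Real.pi := by
    have : α < Real.pi / 2 := Real.arccos_lt_pi_div_two.2 (by linarith)
    linarith [Real.pi_pos]
  have hcosα : Real.cos α = ρ / 2 := Real.cos_arccos (by linarith) (by linarith)
  set c : ℝ → ℂ := circleMap (-1) ρ with hc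
  have hcball : ∀ θ ∈ Ioo (-α) α, c θ ∈ ball (0 : ℂ) 1 := fun θ hθ => by
    rw [hc, circleMap_neg_one_mem_ball_iff hρ0, ← hcosα, ← Real.cos_abs θ]
    exact Real.cos_lt_cos_of_nonneg_of_le_pi (abs_nonneg _) hαπ.le (abs_lt.2 hθ)
  have hcnot : ∀ θ, |θ| = α → c θ ∉ ball (0 : ℂ) 1 := fun θ hθ => by
    rw [hc, circleMap_neg_one_mem_ball_iff hρ0, ← Real.cos_abs θ, hθ, hcosα]; exact lt_irrefl _
  set d : ℝ → ℂ := fun θ => (ball (0 : ℂ) 1).indicator (deriv e) (c θ) * (circleMap 0 ρ θ * Complex.I)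
    with hd
  have hdm : Measurable d := (((measurable_deriv e).indicator measurableSet_ball).comp
    (measurable_circleMap _ _)).mul ((measurable_circleMap _ _).mul_const _)
  have hdn : ∀ θ, ‖d θ‖ₑ = ENNReal.ofReal ρ *
      (ball (0 : ℂ) 1).indicator (fun z => ‖deriv e z‖ₑ) (c θ) := fun θ => by
    have h1 : ‖circleMap 0 ρ θ * Complex.I‖ₑ = ENNReal.ofReal ρ := by
      rw [← ofReal_norm]; simp [abs_of_pos hρ0]
    rw [hd]; simp only [enorm_mul] at h1 ⊢; rw [h1, mul_comm]
    congr 1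
    by_cases hz : c θ ∈ ball (0 : ℂ) 1 <;> simp [indicator, hz]
  have hdL : ∫⁻ θ in Ioo (-Real.pi) Real.pi, ‖d θ‖ₑ < ENNReal.ofReal η := by
    simp_rw [hdn]
    rwa [lintegral_const_mul]
    exact ((measurable_deriv e).enorm.indicator measurableSet_ball).comp (measurable_circleMap _ _)
  have hsub : ∀ {s t : ℝ}, s ∈ Icc (-α) α → t ∈ Icc (-α) α → uIoc s t ⊆ Ioo (-Real.pi) Real.pi :=
    fun {s t} hs ht x hx => ⟨by have := lt_min_iff.1 (show -Real.pi < min s t from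
      lt_min (by linarith [hs.1]) (by linarith [ht.1])); exact (lt_min this.1 this.2).trans hx.1,
      hx.2.trans_lt (max_lt (by linarith [hs.2]) (by linarith [ht.2]))⟩
  have hdi : IntegrableOn d (Ioo (-Real.pi) Real.pi) :=
    ⟨hdm.aestronglyMeasurable, hdL.trans ENNReal.ofReal_lt_top⟩
  have hii : ∀ {s t : ℝ}, s ∈ Icc (-α) α → t ∈ Icc (-α) α → IntervalIntegrable d volume s t :=
    fun hs ht => intervalIntegrable_iff.2 (hdi.mono_set (hsub hs ht))
  have h0α : (0 : ℝ) ∈ Icc (-α) α := ⟨by linarith, hα0.le⟩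
  -- Integrability of the derivative makes this primitive continuous up to the end angles `±α`. It
  -- therefore extends the image of the open arc and supplies its end points.
  set g : ℝ → ℂ := fun t => e (c 0) + ∫ θ in (0 : ℝ)..t, d θ with hg
  have hgc : ContinuousOn g (Icc (-α) α) := by
    have := intervalIntegral.continuousOn_primitive_interval' (f := d) (μ := volume) (a := 0)
      (hii (s := -α) (t := α) ⟨le_rfl, by linarith⟩ ⟨by linarith, le_rfl⟩)
      (by rw [uIcc_of_le (by linarith)]; exact h0α)
    rw [uIcc_of_le (by linarith)] at this
    exact continuousOn_const.add this
  have hgdist : ∀ s ∈ Icc (-α) α, ∀ t ∈ Icc (-α) α, dist (g s) (g t) < η := by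
    intro s hs t ht
    have h1 : g s - g t = ∫ θ in t..s, d θ := by
      simp only [hg]
      rw [add_sub_add_left_eq_sub, intervalIntegral.integral_interval_sub_left (hii h0α hs)
        (hii h0α ht)]
    rw [dist_eq_norm, h1, intervalIntegral.norm_intervalIntegral_eq,
      ← ENNReal.ofReal_lt_ofReal_iff_of_nonneg (norm_nonneg _), ofReal_norm]
    exact ((enorm_integral_le_lintegral_enorm _).trans
      (lintegral_mono_set (hsub ht hs))).trans_lt hdL
  have hIoo : ∀ t ∈ Ioo (-α) α, uIcc 0 t ⊆ Ioo (-α) α := fun t ht =>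
    (ordConnected_Ioo.uIcc_subset ⟨by linarith, hα0⟩ ht)
  have hge : ∀ t ∈ Ioo (-α) α, g t = e (c t) := by
    intro t ht
    have h1 := intervalIntegral.integral_eq_sub_of_hasDerivAt (f := fun θ => e (c θ)) (f' := d)
      (a := 0) (b := t) (fun x hx => by
        have hx' := hcball x (hIoo t ht hx)
        have h2 := (he.differentiableAt (isOpen_ball.mem_nhds hx')).hasDerivAt.scomp_of_eq x
          (hasDerivAt_circleMap (-1) ρ x) rfl
        simp only [hd, indicator_of_mem hx']
        simpa [mul_comm, Function.comp_def] using h2) (hii h0α (Ioo_subset_Icc_self ht))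
    simp only [hg, h1]; ring
  -- If an end point were in the target, continuity of `e.symm` there would put `c t`, a point of
  -- the unit circle, inside the open disc.
  have hend : ∀ t, |t| = α → g t ∉ e.target := by
    intro t ht hgt
    have htI : t ∈ Icc (-α) α := abs_le.1 ht.le
    have hne : (𝓝[Ioo (-α) α] t).NeBot := by
      rw [← mem_closure_iff_nhdsWithin_neBot, closure_Ioo (by linarith)]; exact htI
    have h1 : Tendsto (fun s => e.symm (g s)) (𝓝[Ioo (-α) α] t) (𝓝 (e.symm (g t))) :=
      (e.continuousAt_symm hgt).tendsto.comp ((hgc t htI).mono Ioo_subset_Icc_self)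
    have h2 : Tendsto (fun s => e.symm (g s)) (𝓝[Ioo (-α) α] t) (𝓝 (c t)) := by
      refine ((continuous_circleMap (-1) ρ).continuousWithinAt (s := Ioo (-α) α)).congr' ?_
      filter_upwards [self_mem_nhdsWithin] with s hs'
      rw [hge s hs', e.left_inv (by rw [hs]; exact hcball s hs')]
    refine hcnot t ht ?_
    rw [← tendsto_nhds_unique h1 h2, ← hs]
    exact e.map_target hgt
  have hl : -α ∈ Icc (-α) α := ⟨le_rfl, by linarith⟩
  have hr : α ∈ Icc (-α) α := ⟨by linarith, le_rfl⟩
  refine ⟨g '' Icc (-α) α, g (-α), g α, isCompact_Icc.image_of_continuousOn hgc,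
    mem_image_of_mem g hl, mem_image_of_mem g hr, hend _ (by rw [abs_neg, abs_of_pos hα0]),
    hend _ (abs_of_pos hα0), ?_, ?_, ?_⟩
  · rintro _ ⟨t, ht, rfl⟩; exact hgdist t ht _ hl
  · rintro _ ⟨⟨t, ht, rfl⟩, hne⟩
    simp only [mem_insert_iff, mem_singleton_iff, not_or] at hne
    have ht' : t ∈ Ioo (-α) α := ⟨lt_of_le_of_ne ht.1 fun h => hne.1 (by rw [h]),
      lt_of_le_of_ne ht.2 fun h => hne.2 (by rw [h])⟩
    rw [hge t ht']
    exact e.map_source (by rw [hs]; exact hcball t ht')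
  · intro z hz hzρ
    set θ := Complex.arg (z + 1) with hθ
    have hzn : ‖z + 1‖ = ρ := by rw [← hzρ, dist_eq_norm, sub_neg_eq_add]
    have hzc : c θ = z := by
      simp only [hc, circleMap, hθ, ← hzn]
      rw [Complex.norm_mul_exp_arg_mul_I]; ring
    have hθα : θ ∈ Ioo (-α) α := by
      rw [← hzc, hc, circleMap_neg_one_mem_ball_iff hρ0, ← hcosα, ← Real.cos_abs θ] at hz
      refine abs_lt.1 (not_le.1 fun hle => hz.not_ge ?_)
      exact Real.cos_le_cos_of_nonneg_of_le_pi hα0.le (Complex.abs_arg_le_pi _) hle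
    exact ⟨θ, Ioo_subset_Icc_self hθα, by rw [hge θ hθα, hzc]⟩

/-- The arc of radius `ρ` splits the disc into two parts with disjoint open images `U` and `W`, and
inside the target the frontier of `U` lies on the crosscut. Since `ρ < 1`, `e 0` belongs to `W`,
hence is off `closure U`; since `ε ≤ r` and `a` is off the target, it is at distance at least `ε`
from `a`. So it can serve as the exterior point in `subset_ball_of_crosscut`. -/
theorem dist_lt_of_near_neg_one {e : OpenPartialHomeomorph ℂ ℂ} (hs : e.source = ball 0 1)
    (he : DifferentiableOn ℂ e (ball 0 1)) (hb : Bornology.IsBounded e.target)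
    {ε δ₁ r ρ : ℝ} (hεr : ε ≤ r) (hr : ball (e 0) r ⊆ e.target)
    (hlc : ∀ a ∉ e.target, ∀ b ∉ e.target, dist a b < δ₁ → ∃ B : Set ℂ, IsCompact B ∧
      IsConnected B ∧ a ∈ B ∧ b ∈ B ∧ B ⊆ e.targetᶜ ∧ diam B < ε)
    (hρ : ρ ∈ Ioo (0 : ℝ) 1) (h : ENNReal.ofReal ρ * ∫⁻ θ in Ioo (-Real.pi) Real.pi,
      (ball (0 : ℂ) 1).indicator (fun z => ‖deriv e z‖ₑ) (circleMap (-1) ρ θ)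
      < ENNReal.ofReal (min δ₁ ε)) {z w : ℂ} (hz : z ∈ ball (0 : ℂ) 1) (hw : w ∈ ball (0 : ℂ) 1)
    (hzρ : dist z (-1) < ρ) (hwρ : dist w (-1) < ρ) : dist (e z) (e w) < 2 * ε := by
  obtain ⟨Q, a, b, hQ, haQ, hbQ, ha, hb', hQη, hQG, hzQ⟩ := exists_crosscut hs he hρ h
  have hQδ : Q ⊆ ball a δ₁ := hQη.trans (ball_subset_ball (min_le_left _ _))
  have hQε : Q ⊆ ball a ε := hQη.trans (ball_subset_ball (min_le_right _ _))
  obtain ⟨B, hBc, hBconn, haB, hbB, hBG, hBd⟩ := hlc a ha b hb' (by rw [dist_comm]; exact hQδ hbQ)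
  have htarget : e '' ball 0 1 = e.target := by rw [← hs]; exact e.image_source_eq_target
  have hGc : IsPreconnected e.target := by
    rw [← htarget]
    exact (convex_ball _ _).isPreconnected.image _ he.continuousOn
  have h0 : (0 : ℂ) ∈ ball (0 : ℂ) 1 := mem_ball_self one_pos
  set U : Set ℂ := e '' (ball 0 1 ∩ ball (-1) ρ) with hU
  set W : Set ℂ := e '' (ball 0 1 ∩ (closedBall (-1) ρ)ᶜ) with hW
  have hUo : IsOpen U := e.isOpen_image_of_subset_source (isOpen_ball.inter isOpen_ball)
    (by rw [hs]; exact inter_subset_left)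
  have hWo : IsOpen W := e.isOpen_image_of_subset_source
    (isOpen_ball.inter isClosed_closedBall.isOpen_compl) (by rw [hs]; exact inter_subset_left)
  have hUG : U ⊆ e.target := (image_mono inter_subset_left).trans htarget.subset
  have hdisj : Disjoint U W := by
    rw [disjoint_left]
    rintro _ ⟨x, hx, rfl⟩ ⟨y, hy, hxy⟩
    have := e.injOn (by rw [hs]; exact hy.1) (by rw [hs]; exact hx.1) hxy
    subst this
    exact hy.2 (ball_subset_closedBall hx.2)
  have hclW : ∀ x ∈ closure U, x ∉ W := fun x hx hxW =>
    disjoint_left.1 (hdisj.closure_left hWo) hx hxW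
  have hfr : frontier U ⊆ e.targetᶜ ∪ Q := by
    intro x hx
    by_cases hxG : x ∈ e.target
    · right
      rw [← htarget] at hxG
      obtain ⟨y, hy, rfl⟩ := hxG
      refine hzQ y hy (le_antisymm (not_lt.1 fun hlt => ?_) (not_lt.1 fun hlt => ?_))
      · exact hclW _ (frontier_subset_closure hx) ⟨y, ⟨hy, by simpa using hlt⟩, rfl⟩
      · exact hUo.inter_frontier_eq.subset ⟨⟨y, ⟨hy, hlt⟩, rfl⟩, hx⟩
    · exact Or.inl hxG
  have hsub : U ⊆ ball a ε := by
    refine subset_ball_of_crosscut e.open_target hGc hUG (hb.subset hUG) hBconn.isPreconnected hBG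
      haB hbB (fun x hx => (dist_le_diam_of_mem hBc.isBounded hx haB).trans_lt hBd) hQ.isClosed hQε
      hQG hfr (q := e 0) (e.map_source (by rw [hs]; exact h0)) (fun hx => hclW _ hx ?_) ?_
    · exact ⟨0, ⟨h0, by simpa using hρ.2⟩, rfl⟩
    · rw [dist_comm]
      exact hεr.trans (not_lt.1 fun hlt => ha (hr hlt))
  have hz' : dist (e z) a < ε := hsub ⟨z, ⟨hz, hzρ⟩, rfl⟩
  have hw' : dist (e w) a < ε := hsub ⟨w, ⟨hw, hwρ⟩, rfl⟩
  linarith [dist_triangle_right (e z) (e w) a]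

/-- A bound for the oscillation of a conformal map near the unit circle that depends only on the
area of the image domain, on its inner radius, and on the local connectedness of its complement. -/
theorem exists_oscillation_radius {A : ℝ≥0∞} (hA : A ≠ ∞) {ε δ₁ r : ℝ} (hε : 0 < ε) (hδ₁ : 0 < δ₁)
    (hεr : ε ≤ r) : ∃ δ ∈ Ioo (0 : ℝ) 1, ∀ e : OpenPartialHomeomorph ℂ ℂ, e.source = ball 0 1 →
      DifferentiableOn ℂ e (ball 0 1) → Bornology.IsBounded e.target → volume e.target ≤ A →
      ball (e 0) r ⊆ e.target →
      (∀ a ∉ e.target, ∀ b ∉ e.target, dist a b < δ₁ → ∃ B : Set ℂ, IsCompact B ∧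
        IsConnected B ∧ a ∈ B ∧ b ∈ B ∧ B ⊆ e.targetᶜ ∧ diam B < ε) →
      ∀ u : ℂ, ‖u‖ = 1 → ∀ z ∈ ball (0 : ℂ) 1, ∀ w ∈ ball (0 : ℂ) 1, dist z u < δ → dist w u < δ →
        dist (e z) (e w) ≤ 2 * ε := by
  obtain ⟨δ, hδ, H⟩ := exists_short_arc hA (lt_min hδ₁ hε)
  refine ⟨δ, hδ, fun e hs he hb hvol hr hlc u hu z hz w hw hzu hwu => ?_⟩
  have hu0 : -u ≠ 0 := by rw [neg_ne_zero, ← norm_pos_iff, hu]; exact one_pos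
  -- Precomposing with the rotation that sends `-1` to `u` preserves the image, so the same `δ`
  -- serves every boundary point.
  set e' := (Homeomorph.mulLeft₀ (-u) hu0).transOpenPartialHomeomorph e with he'
  have hval : ∀ x, e' x = e (-u * x) := fun x => rfl
  have hmem : ∀ x, -u * x ∈ ball (0 : ℂ) 1 ↔ x ∈ ball (0 : ℂ) 1 := fun x => by simp [hu]
  have hs' : e'.source = ball 0 1 := by
    have : e'.source = (fun x => -u * x) ⁻¹' e.source := rfl
    rw [this, hs]; ext x; exact hmem x
  have ht' : e'.target = e.target := rfl
  have hed : DifferentiableOn ℂ e' (ball 0 1) :=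
    he.comp (f := fun x => -u * x) (by fun_prop) fun x hx => (hmem x).2 hx
  have hinj : InjOn e' (ball 0 1) := hs' ▸ e'.injOn
  obtain ⟨ρ, hρ, hρ'⟩ := H e' hed hinj (by rw [← hs', e'.image_source_eq_target, ht']; exact hvol)
  have hinv : ∀ x, e x = e' (-u⁻¹ * x) := fun x => by
    rw [hval]; congr 1; field_simp [neg_ne_zero.1 hu0]
  have hmem' : ∀ x ∈ ball (0 : ℂ) 1, -u⁻¹ * x ∈ ball (0 : ℂ) 1 := fun x hx => by simpa [hu] using hx
  have hdist : ∀ x, dist x u < δ → dist (-u⁻¹ * x) (-1) < ρ := fun x hx => by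
    have : -u⁻¹ * x - -1 = -u⁻¹ * (x - u) := by field_simp [neg_ne_zero.1 hu0]; ring
    rw [dist_eq_norm, this, norm_mul, norm_neg, norm_inv, hu, inv_one, one_mul, ← dist_eq_norm]
    exact hx.trans hρ.1
  rw [hinv z, hinv w]
  refine (dist_lt_of_near_neg_one hs' hed hb hεr (by rw [ht', hval, mul_zero]; exact hr) hlc
    ⟨hδ.1.trans hρ.1, hρ.2⟩ hρ' (hmem' z hz) (hmem' w hw) (hdist z hzu) (hdist w hwu)).le

/-! ### Extension to the closed disc and uniform convergence -/

theorem dense_openDisc : Dense {z : ClosedDisc | (z : ℂ) ∈ ball (0 : ℂ) 1} := by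
  rw [Subtype.dense_iff]
  intro z hz
  rw [← closure_ball (0 : ℂ) one_ne_zero] at hz
  refine closure_mono (fun w hw => ?_) hz
  exact ⟨⟨w, ball_subset_closedBall hw⟩, hw, rfl⟩

theorem IsExtensionToClosedDisc.unique {f : ℂ → ℂ} {F G : C(ClosedDisc, ℂ)}
    (hF : IsExtensionToClosedDisc f F) (hG : IsExtensionToClosedDisc f G) : F = G :=
  ContinuousMap.coe_injective (Continuous.ext_on dense_openDisc F.continuous G.continuous
    fun z hz => (hF z hz).trans (hG z hz).symm)

/-- Small oscillation near a boundary point is the Cauchy criterion for the limit there, and a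
function with limits at all points of the closure extends continuously. -/
theorem existsUnique_isExtensionToClosedDisc {f : ℂ → ℂ} (hf : ContinuousOn f (ball 0 1))
    (hosc : ∀ ε > 0, ∃ δ > 0, ∀ u : ℂ, ‖u‖ = 1 → ∀ z ∈ ball (0 : ℂ) 1, ∀ w ∈ ball (0 : ℂ) 1,
      dist z u < δ → dist w u < δ → dist (f z) (f w) ≤ ε) :
    ∃! F : C(ClosedDisc, ℂ), IsExtensionToClosedDisc f F := by
  have hcl : closedBall (0 : ℂ) 1 = closure (ball 0 1) := (closure_ball 0 one_ne_zero).symm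
  have hlim : ∀ x ∈ closedBall (0 : ℂ) 1, ∃ y, Tendsto f (𝓝[ball 0 1] x) (𝓝 y) := by
    intro x hx
    by_cases hxb : x ∈ ball (0 : ℂ) 1
    · exact ⟨f x, hf x hxb⟩
    · have hx1 : ‖x‖ = 1 := by
        rw [mem_closedBall_zero_iff] at hx
        rw [mem_ball_zero_iff] at hxb
        linarith
      have : (𝓝[ball 0 1] x).NeBot := mem_closure_iff_nhdsWithin_neBot.1 (hcl ▸ hx)
      refine CompleteSpace.complete (Metric.cauchy_iff.2 ⟨inferInstance, fun ε hε => ?_⟩)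
      obtain ⟨δ, hδ, h⟩ := hosc (ε / 2) (half_pos hε)
      refine ⟨f '' (ball 0 1 ∩ ball x δ), image_mem_map
        (inter_mem_nhdsWithin _ (ball_mem_nhds x hδ)), ?_⟩
      rintro _ ⟨z, hz, rfl⟩ _ ⟨w, hw, rfl⟩
      exact (h x hx1 z hz.1 w hw.1 hz.2 hw.2).trans_lt (half_lt_self hε)
  have hc := continuousOn_extendFrom hcl.subset hlim
  refine ⟨⟨_, hc.domRestrict⟩, fun z hz => ?_, fun G hG => hG.unique fun z hz => ?_⟩ <;>
  · exact extendFrom_extends hf _ hz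

/-- Locally uniformly convergent maps with uniformly controlled oscillation near the circle have
uniformly convergent extensions. -/
theorem tendsto_extensions {f : ℕ → ℂ → ℂ} {g : ℂ → ℂ}
    (hconv : ∀ K : Set ℂ, IsCompact K → K ⊆ ball (0 : ℂ) 1 → TendstoUniformlyOn f g atTop K)
    (hosc : ∀ ε > 0, ∃ δ > 0, ∀ᶠ n in atTop, ∀ u : ℂ, ‖u‖ = 1 → ∀ z ∈ ball (0 : ℂ) 1,
      ∀ w ∈ ball (0 : ℂ) 1, dist z u < δ → dist w u < δ → dist (f n z) (f n w) ≤ ε)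
    (hoscg : ∀ ε > 0, ∃ δ > 0, ∀ u : ℂ, ‖u‖ = 1 → ∀ z ∈ ball (0 : ℂ) 1, ∀ w ∈ ball (0 : ℂ) 1,
      dist z u < δ → dist w u < δ → dist (g z) (g w) ≤ ε)
    {F : ℕ → C(ClosedDisc, ℂ)} {G : C(ClosedDisc, ℂ)}
    (hF : ∀ n, IsExtensionToClosedDisc (f n) (F n)) (hG : IsExtensionToClosedDisc g G) :
    Tendsto F atTop (𝓝 G) := by
  rw [Metric.tendsto_nhds]
  intro ε hε
  obtain ⟨δ₁, hδ₁, h₁⟩ := hosc (ε / 4) (by positivity)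
  obtain ⟨δ₂, hδ₂, h₂⟩ := hoscg (ε / 4) (by positivity)
  set s : ℝ := min (min δ₁ δ₂ / 2) (1 / 2) with hs
  have hs0 : 0 < s := by positivity
  have hs1 : s ≤ 1 / 2 := min_le_right _ _
  have hsm : s ≤ min δ₁ δ₂ / 2 := min_le_left _ _
  have hsδ₁ : s < δ₁ := by have := min_le_left δ₁ δ₂; linarith
  have hsδ₂ : s < δ₂ := by have := min_le_right δ₁ δ₂; linarith
  have hK := Metric.tendstoUniformlyOn_iff.1 (hconv (closedBall 0 (1 - s))
    (isCompact_closedBall _ _) (closedBall_subset_ball (by linarith))) (ε / 4) (by positivity)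
  filter_upwards [h₁, hK] with n hn hnK
  have hball : ∀ z ∈ ball (0 : ℂ) 1, dist (f n z) (g z) ≤ 3 * (ε / 4) := by
    intro z hz
    rcases le_or_gt ‖z‖ (1 - s) with hzs | hzs
    · have := hnK z (by simpa using hzs)
      rw [dist_comm] at this; linarith
    · rw [mem_ball_zero_iff] at hz
      have hz0 : ‖z‖ ≠ 0 := by linarith
      have hz0' : (‖z‖ : ℂ) ≠ 0 := by exact_mod_cast hz0
      set u : ℂ := z / ‖z‖ with hu
      have hu1 : ‖u‖ = 1 := by simp [hu, hz0]
      have hzu : dist z u < s := by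
        have : z - u = ((‖z‖ - 1 : ℝ) : ℂ) * u := by
          rw [hu]; push_cast; field_simp
        rw [dist_eq_norm, this, norm_mul, hu1, mul_one, Complex.norm_real, Real.norm_eq_abs,
          abs_of_neg (by linarith)]
        linarith
      -- Near the circle, `z` is compared with the point `v` on the same radius, which lies in the
      -- compact disc where convergence is already uniform. Both `z` and `v` are within the
      -- oscillation radii of `u`.
      set v : ℂ := ((1 - s : ℝ) : ℂ) * u with hv
      have hvn : ‖v‖ = 1 - s := by
        rw [hv, norm_mul, hu1, mul_one, Complex.norm_real, Real.norm_eq_abs,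
          abs_of_pos (by linarith)]
      have hvu : dist v u ≤ s := by
        have : v - u = ((-s : ℝ) : ℂ) * u := by rw [hv]; push_cast; ring
        rw [dist_eq_norm, this, norm_mul, hu1, mul_one, Complex.norm_real, norm_neg,
          Real.norm_eq_abs, abs_of_pos hs0]
      have hvb : v ∈ ball (0 : ℂ) 1 := by rw [mem_ball_zero_iff, hvn]; linarith
      have e1 := hn u hu1 z (by simpa using hz) v hvb (hzu.trans hsδ₁) (hvu.trans_lt hsδ₁)
      have e2 := h₂ u hu1 z (by simpa using hz) v hvb (hzu.trans hsδ₂) (hvu.trans_lt hsδ₂)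
      have e3 := hnK v (by simp [hvn])
      rw [dist_comm] at e3
      rw [dist_comm (g z)] at e2
      linarith [dist_triangle4 (f n z) (f n v) (g v) (g z)]
  refine lt_of_le_of_lt ((ContinuousMap.dist_le (by positivity)).2 fun z => ?_)
    (show 3 * (ε / 4) < ε by linarith)
  have hclosed : IsClosed {z : ClosedDisc | dist (F n z) (G z) ≤ 3 * (ε / 4)} :=
    isClosed_le (by fun_prop) continuous_const
  refine closure_minimal (fun w hw => ?_) hclosed (dense_openDisc z)
  change dist (F n w) (G w) ≤ _
  rw [hF n w hw, hG w hw]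
  exact hball w hw

/-! ### Images of curves and weak convergence -/

theorem CurveSpace.continuous_image {E F : Type*} [MetricSpace E] [MetricSpace F] (f : C(E, F)) :
    Continuous (CurveSpace.image f) :=
  SeparationQuotient.continuous_lift
    (SeparationQuotient.continuous_mk.comp (ParamCurve.continuous_image f))

/-- The identity reparametrization already achieves the bound. That it does not depend on the curve
is what makes tightness arguments unnecessary. -/
theorem CurveSpace.dist_image_le {E F : Type*} [MetricSpace E] [CompactSpace E] [MetricSpace F]
    (f g : C(E, F)) (x : CurveSpace E) :
    dist (CurveSpace.image f x) (CurveSpace.image g x) ≤ dist f g := by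
  obtain ⟨γ, rfl⟩ := SeparationQuotient.surjective_mk x
  refine (ParamCurve.reparamDist_le _ _ (OrderIso.refl _)).trans ?_
  exact (ContinuousMap.dist_le (α := unitInterval) (β := F) dist_nonneg).2
    fun t => ContinuousMap.dist_apply_le_dist (f := f) (g := g) _

/-- The continuous mapping theorem for a uniformly convergent sequence of continuous maps. -/
theorem tendstoInDistribution_of_uniform {E E' Ω' : Type*} {Ω : ℕ → Type*}
    [∀ n, MeasurableSpace (Ω n)] [MeasurableSpace Ω'] {P : ∀ n, Measure (Ω n)}
    [∀ n, IsProbabilityMeasure (P n)] {P' : Measure Ω'} [IsProbabilityMeasure P']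
    [TopologicalSpace E] [MeasurableSpace E] [OpensMeasurableSpace E]
    [PseudoMetricSpace E'] [MeasurableSpace E'] [BorelSpace E'] {X : ∀ n, Ω n → E} {Z : Ω' → E}
    (h : TendstoInDistribution X atTop Z P P') {g : ℕ → E → E'} {g' : E → E'}
    (hg : ∀ n, Continuous (g n)) (hg' : Continuous g') {c : ℕ → ℝ} (hc : Tendsto c atTop (𝓝 0))
    (hgc : ∀ n x, dist (g n x) (g' x) ≤ c n) :
    TendstoInDistribution (fun n ω => g n (X n ω)) atTop (fun ω => g' (Z ω)) P P' := by
  have h' := h.continuous_comp hg'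
  have hm : ∀ n, AEMeasurable (fun ω => g n (X n ω)) (P n) := fun n =>
    (hg n).measurable.comp_aemeasurable (h.forall_aemeasurable n)
  refine ⟨hm, h'.aemeasurable_limit, ?_⟩
  -- Weak convergence may be tested on bounded Lipschitz functions. For such a function with
  -- constant `K`, replacing `g n` by `g'` changes the integral by at most `K * c n`, and for `g'`
  -- the usual continuous mapping theorem applies.
  refine tendsto_iff_forall_lipschitz_integral_tendsto.2 ?_
  rintro φ ⟨M, hM⟩ ⟨K, hK⟩
  have h1 := tendsto_iff_forall_lipschitz_integral_tendsto.1 h'.tendsto φ ⟨M, hM⟩ ⟨K, hK⟩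
  have h2 : Tendsto (fun n => (K : ℝ) * c n) atTop (𝓝 0) := by simpa using hc.const_mul (K : ℝ)
  refine tendsto_of_tendsto_of_dist h1 (squeeze_zero (fun _ => dist_nonneg) (fun n => ?_) h2)
  have hint : ∀ {Y : Ω n → E'}, AEMeasurable Y (P n) → Integrable (fun ω => φ (Y ω)) (P n) := by
    intro Y hY
    obtain ⟨ω₀⟩ := (P n).nonempty_of_neZero
    refine Integrable.of_bound ((hK.continuous.measurable.comp_aemeasurable hY).aestronglyMeasurable)
      (‖φ (Y ω₀)‖ + M) (Eventually.of_forall fun ω => ?_)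
    have := hM (Y ω) (Y ω₀)
    rw [dist_eq_norm] at this
    linarith [norm_le_norm_add_norm_sub' (φ (Y ω)) (φ (Y ω₀))]
  simp only [ProbabilityMeasure.coe_mk]
  rw [integral_map (h'.forall_aemeasurable n) hK.continuous.aestronglyMeasurable,
    integral_map (hm n) hK.continuous.aestronglyMeasurable, dist_comm, dist_eq_norm,
    ← integral_sub (hint (hm n)) (hint (h'.forall_aemeasurable n))]
  refine (norm_integral_le_of_norm_le_const (C := K * c n)
    (Eventually.of_forall fun ω => ?_)).trans (by simp)
  rw [← dist_eq_norm]
  exact (hK.dist_le_mul _ _).trans (by gcongr; exact hgc n _)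

/-! ### Equicontinuity along the sequence and conclusion -/

theorem IsConformalOntoDisc.symm_differentiableOn {φ : OpenPartialHomeomorph ℂ ℂ} {U : Set ℂ}
    (h : IsConformalOntoDisc φ U) : DifferentiableOn ℂ φ.symm (ball 0 1) := by
  rw [← h.target_eq]
  exact OpenPartialHomeomorph.differentiableOn_symm_of_complex (by
    rw [h.source_eq]; exact h.differentiableOn)

theorem IsConformalOntoDisc.symm_zero_mem {φ : OpenPartialHomeomorph ℂ ℂ} {U : Set ℂ}
    (h : IsConformalOntoDisc φ U) : φ.symm 0 ∈ U := by
  rw [← h.source_eq]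
  exact φ.map_target (by rw [h.target_eq]; exact mem_ball_self one_pos)

/-- Equicontinuity at the unit circle of the inverse conformal maps onto domains with uniformly
locally connected complements, given uniform bounds for the areas and the inner radii. -/
theorem exists_uniform_oscillation_radius {Λ : ℕ → Set ℂ}
    (hb : ∀ n, Bornology.IsBounded (Λ n)) (hulc : UniformlyLocallyConnected fun n => (Λ n)ᶜ)
    {φ : ℕ → OpenPartialHomeomorph ℂ ℂ} (hφ : ∀ n, IsConformalOntoDisc (φ n) (Λ n))
    {A : ENNReal} (hA : A ≠ ⊤) {r : ℝ} (hr : 0 < r) {ε : ℝ} (hε : 0 < ε) :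
    ∃ δ > 0, ∀ n, volume (Λ n) ≤ A → ball ((φ n).symm 0) r ⊆ Λ n →
      ∀ u : ℂ, ‖u‖ = 1 → ∀ z ∈ ball (0 : ℂ) 1, ∀ w ∈ ball (0 : ℂ) 1, dist z u < δ → dist w u < δ →
        dist ((φ n).symm z) ((φ n).symm w) ≤ ε := by
  -- `ε / 2` absorbs the factor `2` in the oscillation bound, and `r` keeps the trapping disc away
  -- from the image of the centre.
  have hε' : 0 < min (ε / 2) r := lt_min (half_pos hε) hr
  obtain ⟨δ₁, hδ₁, hB⟩ := hulc.2 _ hε'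
  obtain ⟨δ, hδ, H⟩ := exists_oscillation_radius hA hε' hδ₁ (min_le_right _ _)
  refine ⟨δ, hδ.1, fun n hn hrn u hu z hz w hw hzu hwu => ?_⟩
  have ht : (φ n).symm.target = Λ n := (hφ n).source_eq
  refine (H (φ n).symm (hφ n).target_eq (hφ n).symm_differentiableOn (by rw [ht]; exact hb n)
    (by rw [ht]; exact hn) (by rw [ht]; exact hrn) ?_ u hu z hz w hw hzu hwu).trans ?_
  · rw [ht]; exact hB n
  · linarith [min_le_left (ε / 2) r]

theorem proposition3p1
    -- the domains
    (Λ : ℕ → Set ℂ) (L : Set ℂ)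
    (hΛ : ∀ n, IsBoundedSimplyConnectedDomain (Λ n)) (hL : IsBoundedSimplyConnectedDomain L)
    (hconv : CaratheodoryConvergence Λ L)
    (hulc : UniformlyLocallyConnected fun n => (Λ n)ᶜ)
    -- the conformal maps
    (φ : ℕ → OpenPartialHomeomorph ℂ ℂ) (φL : OpenPartialHomeomorph ℂ ℂ)
    (hφ : ∀ n, IsConformalOntoDisc (φ n) (Λ n)) (hφL : IsConformalOntoDisc φL L)
    (hφconv : ∀ K : Set ℂ, IsCompact K → K ⊆ Metric.ball (0 : ℂ) 1 →
      TendstoUniformlyOn (fun n => ((φ n).symm : ℂ → ℂ)) (φL.symm : ℂ → ℂ) Filter.atTop K)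
    -- the random curves in the closed unit disc
    {Ω : ℕ → Type*} [∀ n, MeasurableSpace (Ω n)] (P : ∀ n, MeasureTheory.Measure (Ω n))
    [∀ n, MeasureTheory.IsProbabilityMeasure (P n)]
    {Ω' : Type*} [MeasurableSpace Ω'] (P' : MeasureTheory.Measure Ω')
    [MeasureTheory.IsProbabilityMeasure P']
    (γD : ∀ n, Ω n → CurveSpace ClosedDisc) (γD' : Ω' → CurveSpace ClosedDisc)
    (hγD : ∀ n, Measurable (γD n)) (hγD' : Measurable γD')
    (hweak : MeasureTheory.TendstoInDistribution γD Filter.atTop γD' P P') :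
    -- the inverse maps extend continuously to the closed disc
    (∀ n, ∃! F : C(ClosedDisc, ℂ), IsExtensionToClosedDisc (φ n).symm F) ∧
    (∃! F : C(ClosedDisc, ℂ), IsExtensionToClosedDisc φL.symm F) ∧
    -- and the images of the curves under the extensions are random curves that converge weakly
    ∀ (F : ℕ → C(ClosedDisc, ℂ)) (F' : C(ClosedDisc, ℂ)),
      (∀ n, IsExtensionToClosedDisc (φ n).symm (F n)) → IsExtensionToClosedDisc φL.symm F' →
      (∀ n, Measurable fun ω => CurveSpace.image (F n) (γD n ω)) ∧
      (Measurable fun ω => CurveSpace.image F' (γD' ω)) ∧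
      MeasureTheory.TendstoInDistribution (fun n ω => CurveSpace.image (F n) (γD n ω))
        Filter.atTop (fun ω => CurveSpace.image F' (γD' ω)) P P' := by
  -- For each fixed `n`, its own area and inner radius suffice; this gives the extension for every
  -- `n`, while `hosc` gives uniformity only for large `n`.
  have hoscn : ∀ n, ∀ ε > 0, ∃ δ > 0, ∀ u : ℂ, ‖u‖ = 1 → ∀ z ∈ ball (0 : ℂ) 1,
      ∀ w ∈ ball (0 : ℂ) 1, dist z u < δ → dist w u < δ →
      dist ((φ n).symm z) ((φ n).symm w) ≤ ε := by
    intro n ε hε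
    obtain ⟨r, hr, hrn⟩ := Metric.isOpen_iff.1 (hΛ n).isOpen _ (hφ n).symm_zero_mem
    obtain ⟨δ, hδ, h⟩ := exists_uniform_oscillation_radius (fun n => (hΛ n).isBounded) hulc hφ
      ((hΛ n).isBounded.measure_lt_top (μ := volume)).ne hr hε
    exact ⟨δ, hδ, h n le_rfl hrn⟩
  have hpt : ∀ z ∈ ball (0 : ℂ) 1,
      Tendsto (fun n => (φ n).symm z) atTop (𝓝 (φL.symm z)) := fun z hz =>
    (hφconv {z} isCompact_singleton (singleton_subset_iff.2 hz)).tendsto_at rfl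
  have hosc : ∀ ε > 0, ∃ δ > 0, ∀ᶠ n in atTop, ∀ u : ℂ, ‖u‖ = 1 → ∀ z ∈ ball (0 : ℂ) 1,
      ∀ w ∈ ball (0 : ℂ) 1, dist z u < δ → dist w u < δ →
      dist ((φ n).symm z) ((φ n).symm w) ≤ ε := by
    intro ε hε
    obtain ⟨R, hR⟩ := hconv.eventually_subset_ball (fun n => (hΛ n).isOpen)
      (fun n => (hΛ n).isSimplyConnected.isPathConnected.isConnected.isPreconnected) hL.isOpen
      hL.isBounded hφL.symm_zero_mem hulc
    obtain ⟨V, hV, hVΛ⟩ := hconv.eventually_nhds_subset _ hφL.symm_zero_mem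
    obtain ⟨r, hr, hrV⟩ := Metric.mem_nhds_iff.1 hV
    obtain ⟨δ, hδ, h⟩ := exists_uniform_oscillation_radius (fun n => (hΛ n).isBounded) hulc hφ
      -- Half of `r` is given up because the centre `(φ n).symm 0` is only eventually within `r / 2`
      -- of `φL.symm 0`.
      (measure_ball_lt_top (μ := volume) (x := φL.symm 0) (r := R)).ne (half_pos hr) hε
    refine ⟨δ, hδ, ?_⟩
    filter_upwards [hR, hVΛ, hpt 0 (mem_ball_self one_pos) (ball_mem_nhds _ (half_pos hr))]
      with n hn hVn h0
    refine h n (measure_mono hn) (Subset.trans (ball_subset_ball' ?_) (hrV.trans hVn))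
    rw [mem_preimage, mem_ball] at h0
    linarith
  -- The non-strict bound passes to the pointwise limit, so local connectedness of the complement of
  -- `L` is not needed.
  have hoscL : ∀ ε > 0, ∃ δ > 0, ∀ u : ℂ, ‖u‖ = 1 → ∀ z ∈ ball (0 : ℂ) 1,
      ∀ w ∈ ball (0 : ℂ) 1, dist z u < δ → dist w u < δ →
      dist (φL.symm z) (φL.symm w) ≤ ε := by
    intro ε hε
    obtain ⟨δ, hδ, h⟩ := hosc ε hε
    refine ⟨δ, hδ, fun u hu z hz w hw hzu hwu => ?_⟩
    refine le_of_tendsto ((hpt z hz).dist (hpt w hw)) ?_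
    filter_upwards [h] with n hn
    exact hn u hu z hz w hw hzu hwu
  refine ⟨fun n => existsUnique_isExtensionToClosedDisc
    (hφ n).symm_differentiableOn.continuousOn (hoscn n),
    existsUnique_isExtensionToClosedDisc hφL.symm_differentiableOn.continuousOn hoscL,
    fun F F' hF hF' => ⟨fun n => (CurveSpace.continuous_image _).measurable.comp (hγD n),
      (CurveSpace.continuous_image _).measurable.comp hγD', ?_⟩⟩
  have hFF : Tendsto (fun n => dist (F n) F') atTop (𝓝 0) :=
    tendsto_iff_dist_tendsto_zero.1 (tendsto_extensions hφconv hosc hoscL hF hF')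
  exact tendstoInDistribution_of_uniform hweak (fun n => CurveSpace.continuous_image (F n))
    (CurveSpace.continuous_image F') hFF fun n x => CurveSpace.dist_image_le _ _ x
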